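/- Let $X,Y$ be random variables on a probability space such that $(X,Y)$ is bivariate Gaussian with mean $0$, unit variances and correlation $\rho\in(-1,1)$, and let $T=aX+bY$ with $0<a<b$. Put $\sigma_T=\sqrt{a^2+b^2+2\rho ab}$. Logarithms are natural, $p$ denotes Lebesgue densities, $p_{U|T}=p_{U,T}/p_T$, and $I(U;V)\in[0,\infty]$ denotes mutual information (the Kullback--Leibler divergence of the joint law from the product of the marginals). A bivariate partial information decomposition (PID) consists of a redundancy $R$, unique informations $U_X,U_Y$ and a synergy $S$ in $[-\infty,\infty]$ with $$I(T;X)=R+U_X,\qquad I(T;Y)=R+U_Y,\qquad I(T;X,Y)=R+U_X+U_Y+S.$$ * The PID $\mathfrak d_{\min}$ has redundancy $R^{\min}=\mathbb E\min(I_X(T),I_Y(T))$, where for $U\in\{X,Y\}$ the specific information is $$I_U(t)=\mathbb E\Big[\log\tfrac{p_{U,T}(U,T)}{p_U(U)\,p_T(T)}\,\Big|\,T=t\Big]=\int p_{U|T}(u|t)\log\frac{p_{U,T}(u,t)}{p_U(u)\,p_T(t)}\,du .$$ Its other atoms are $U_X^{\min}=I(T;X)-R^{\min}$, $U_Y^{\min}=I(T;Y)-R^{\min}$,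 $S^{\min}=I(T;X,Y)-(R^{\min}+U_X^{\min}+U_Y^{\min})$. * The PID $\mathfrak d_{\mathrm{PM}}$ has redundancy $R^{\mathrm{PM}}=R^+-R^-$ with $$R^+=\mathbb E\min\big(-\log p_X(X),-\log p_Y(Y)\big),\qquad R^-=\mathbb E\min\big(-\log p_{X|T}(X|T),-\log p_{Y|T}(Y|T)\big),$$ unique informations $U_V^{\mathrm{PM}}=\big(\mathbb E[-\log p_V(V)]-R^+\big)-\big(\mathbb E[-\log p_{V|T}(V|T)]-R^-\big)$ for $V\in\{X,Y\}$, and $S^{\mathrm{PM}}=I(T;X,Y)-(R^{\mathrm{PM}}+U^{\mathrm{PM}}_X+U^{\mathrm{PM}}_Y)$. Then $X$, $Y$, $T$, $(X,T)$, $(Y,T)$ have densities, all integrals above converge absolutely (those defining $I_U(t)$ for almost every $t$ with respect to the law of $T$), both decompositions satisfy the three PID equations, $I(X;Y)=-\log\sqrt{1-\rho^2}$, and 1. $R^{\min}=-\log b+\log\sigma_T+I(X;Y)=\log\dfrac{\sigma_T}{b\sqrt{1-\rho^2}}$, $\quad U_X^{\min}=0$, $\quad U_Y^{\min}=\log\dfrac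 ba$, $\quad S^{\min}=\infty$; 2. $R^{\mathrm{PM}}=-\log a+\log\sigma_T+I(X;Y)-\dfrac{\sqrt{1-\rho^2}}{\pi}$, $\quad U_X^{\mathrm{PM}}=\dfrac{\sqrt{1-\rho^2}}{\pi}-\log\dfrac ba$, $\quad U_Y^{\mathrm{PM}}=\dfrac{\sqrt{1-\rho^2}}{\pi}$, $\quad S^{\mathrm{PM}}=\infty$. -/

import Mathlib

open MeasureTheory ProbabilityTheory
open scoped ENNReal

noncomputable section

namespace PID

variable {Ω : Type*} [MeasurableSpace Ω]

/-- `(X, Y)` is normalized Gaussian with correlation `ρ`: its law is the bivariate Gaussian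
distribution with mean zero and covariance matrix `(1, ρ; ρ, 1)`. -/
def IsNormalizedGaussianPair (P : Measure Ω) (X Y : Ω → ℝ) (ρ : ℝ) : Prop :=
  P.map (fun ω => !₂[X ω, Y ω]) =
    multivariateGaussian (0 : EuclideanSpace ℝ (Fin 2)) !![1, ρ; ρ, 1]

/-- The mutual information `I(U;V)` in nats, with values in `[0, ∞]`: the Kullback–Leibler
divergence of the joint law from the product of the marginal laws. -/
def mutualInfo {α β : Type*} [MeasurableSpace α] [MeasurableSpace β]
    (P : Measure Ω) (U : Ω → α) (V : Ω → β) : ℝ≥0∞ :=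
  InformationTheory.klDiv (P.map fun ω => (U ω, V ω)) ((P.map U).prod (P.map V))

/-- The Lebesgue density `p_U` of a real random variable, as a real-valued function. -/
def dens (P : Measure Ω) (U : Ω → ℝ) (u : ℝ) : ℝ :=
  (pdf U P volume u).toReal

/-- The joint Lebesgue density `p_{U,T}` of a pair of real random variables. -/
def jointDens (P : Measure Ω) (U T : Ω → ℝ) (u t : ℝ) : ℝ :=
  (pdf (fun ω => (U ω, T ω)) P volume (u, t)).toReal

/-- The conditional density `p_{U|T}(u|t) = p_{U,T}(u,t) / p_T(t)`. -/
def condDens (P : Measure Ω) (U T : Ω → ℝ) (u t : ℝ) : ℝ :=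
  jointDens P U T u t / dens P T t

/-! ### Partial information decompositions of two predictors -/

/-- The four atoms of a bivariate partial information decomposition: redundant information,
the unique informations of the two predictors, and synergistic information. -/
structure Decomposition where
  /-- redundant information -/
  R : EReal
  /-- unique information of the first predictor -/
  UX : EReal
  /-- unique information of the second predictor -/
  UY : EReal
  /-- synergistic information -/
  S : EReal

/-- The equations of a partial information decomposition of the information that `X` and `Y`
have about the target `T`. -/
structure IsPID (P : Measure Ω) (T X Y : Ω → ℝ) (d : Decomposition) : Prop where
  eq_X : (mutualInfo P T X : EReal) = d.R + d.UX
  eq_Y : (mutualInfo P T Y : EReal) = d.R + d.UY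
  eq_XY : (mutualInfo P T (fun ω => (X ω, Y ω)) : EReal) = d.R + d.UX + d.UY + d.S

/-! ### The decomposition of the redundancy measure `I_∩^min` -/

/-- The integrand `p_{U|T}(u|t) log (p_{U,T}(u,t) / (p_U(u) p_T(t)))` of the specific
information. -/
def specificIntegrand (P : Measure Ω) (T U : Ω → ℝ) (t u : ℝ) : ℝ :=
  condDens P U T u t * Real.log (jointDens P U T u t / (dens P U u * dens P T t))

/-- The specific information
`I_U(t) = 𝔼[log (p_{U,T}(U,T) / (p_U(U) p_T(T))) | T = t]` that `U` has about `T = t`. -/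
def specificInfo (P : Measure Ω) (T U : Ω → ℝ) (t : ℝ) : ℝ :=
  ∫ u, specificIntegrand P T U t u

/-- The random variable `min (I_X(T), I_Y(T))`. -/
def minSpecificInfo (P : Measure Ω) (T X Y : Ω → ℝ) (ω : Ω) : ℝ :=
  min (specificInfo P T X (T ω)) (specificInfo P T Y (T ω))

/-- The redundancy `I_∩^min(T;X,Y) = 𝔼 min (I_X(T), I_Y(T))`. -/
def redMin (P : Measure Ω) (T X Y : Ω → ℝ) : ℝ :=
  ∫ ω, minSpecificInfo P T X Y ω ∂P

/-- The decomposition induced by `I_∩^min`. -/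
def dMin (P : Measure Ω) (T X Y : Ω → ℝ) : Decomposition where
  R := (redMin P T X Y : EReal)
  UX := (mutualInfo P T X : EReal) - (redMin P T X Y : EReal)
  UY := (mutualInfo P T Y : EReal) - (redMin P T X Y : EReal)
  S := (mutualInfo P T (fun ω => (X ω, Y ω)) : EReal)
    - ((redMin P T X Y : EReal)
      + ((mutualInfo P T X : EReal) - (redMin P T X Y : EReal))
      + ((mutualInfo P T Y : EReal) - (redMin P T X Y : EReal)))

/-- All integrals that define `I_∩^min` converge absolutely (the inner ones for almost every
value of the target), so that none of them takes its default value. -/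
structure MinWellDefined (P : Measure Ω) (T X Y : Ω → ℝ) : Prop where
  specific_X : ∀ᵐ t ∂(P.map T), Integrable (specificIntegrand P T X t) volume
  specific_Y : ∀ᵐ t ∂(P.map T), Integrable (specificIntegrand P T Y t) volume
  min_specific : Integrable (minSpecificInfo P T X Y) P

/-! ### The decomposition of the pointwise redundancy measure `I_∩^PM`

Pointwise information is split into specificity `-log p_U(u)` and ambiguity `-log p_{U|T}(u|t)`;
a minimum over the predictors is taken for each of the two separately. -/

/-- The pointwise specificity `-log p_U(U)`. -/
def ptSpecificity (P : Measure Ω) (U : Ω → ℝ) (ω : Ω) : ℝ :=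
  -Real.log (dens P U (U ω))

/-- The pointwise ambiguity `-log p_{U|T}(U|T)`. -/
def ptAmbiguity (P : Measure Ω) (T U : Ω → ℝ) (ω : Ω) : ℝ :=
  -Real.log (condDens P U T (U ω) (T ω))

/-- The specificity `I^{PM,+}(T;U) = 𝔼[-log p_U(U)]` of a single predictor. -/
def specificity (P : Measure Ω) (U : Ω → ℝ) : ℝ :=
  ∫ ω, ptSpecificity P U ω ∂P

/-- The ambiguity `I^{PM,-}(T;U) = 𝔼[-log p_{U|T}(U|T)]` of a single predictor. -/
def ambiguity (P : Measure Ω) (T U : Ω → ℝ) : ℝ :=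
  ∫ ω, ptAmbiguity P T U ω ∂P

/-- The redundant specificity `I_∩^{PM,+}(T;X,Y)`. -/
def redSpecificity (P : Measure Ω) (X Y : Ω → ℝ) : ℝ :=
  ∫ ω, min (ptSpecificity P X ω) (ptSpecificity P Y ω) ∂P

/-- The redundant ambiguity `I_∩^{PM,-}(T;X,Y)`. -/
def redAmbiguity (P : Measure Ω) (T X Y : Ω → ℝ) : ℝ :=
  ∫ ω, min (ptAmbiguity P T X ω) (ptAmbiguity P T Y ω) ∂P

/-- The redundancy `I_∩^PM = I_∩^{PM,+} - I_∩^{PM,-}`. -/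
def redPM (P : Measure Ω) (T X Y : Ω → ℝ) : ℝ :=
  redSpecificity P X Y - redAmbiguity P T X Y

/-- Unique information of `X`: unique specificity minus unique ambiguity. -/
def uniquePMX (P : Measure Ω) (T X Y : Ω → ℝ) : ℝ :=
  (specificity P X - redSpecificity P X Y) - (ambiguity P T X - redAmbiguity P T X Y)

/-- Unique information of `Y`: unique specificity minus unique ambiguity. -/
def uniquePMY (P : Measure Ω) (T X Y : Ω → ℝ) : ℝ :=
  (specificity P Y - redSpecificity P X Y) - (ambiguity P T Y - redAmbiguity P T X Y)

/-- The decomposition induced by `I_∩^PM`. -/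
def dPM (P : Measure Ω) (T X Y : Ω → ℝ) : Decomposition where
  R := (redPM P T X Y : EReal)
  UX := (uniquePMX P T X Y : EReal)
  UY := (uniquePMY P T X Y : EReal)
  S := (mutualInfo P T (fun ω => (X ω, Y ω)) : EReal)
    - ((redPM P T X Y : EReal) + (uniquePMX P T X Y : EReal) + (uniquePMY P T X Y : EReal))

/-- All expectations that define the decomposition of `I_∩^PM` converge absolutely. -/
structure PMWellDefined (P : Measure Ω) (T X Y : Ω → ℝ) : Prop where
  specificity_X : Integrable (ptSpecificity P X) P
  specificity_Y : Integrable (ptSpecificity P Y) P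
  ambiguity_X : Integrable (ptAmbiguity P T X) P
  ambiguity_Y : Integrable (ptAmbiguity P T Y) P
  red_specificity : Integrable (fun ω => min (ptSpecificity P X ω) (ptSpecificity P Y ω)) P
  red_ambiguity : Integrable (fun ω => min (ptAmbiguity P T X ω) (ptAmbiguity P T Y ω)) P

/-- The densities that enter the definitions exist. -/
structure HasDensities (P : Measure Ω) (T X Y : Ω → ℝ) : Prop where
  pdf_X : HasPDF X P volume
  pdf_Y : HasPDF Y P volume
  pdf_T : HasPDF T P volume
  pdf_XT : HasPDF (fun ω => (X ω, T ω)) P volume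
  pdf_YT : HasPDF (fun ω => (Y ω, T ω)) P volume

end PID

end

/-!
Each of the pairs `(X, Y)`, `(T, X)`, `(T, Y)` is a Gaussian regression `U = k V + R` with `R`
independent of `V` and of positive variance `w` (`IsGaussianRegression`). This holds because linear
combinations of `X` and `Y` are jointly Gaussian, so that uncorrelated ones are independent. The
joint density is then the product of the density of `V` and of the conditional density `N(k v, w)`,
and all information quantities are expectations of quadratic functions: for `U` of variance `1`,
`I(V;U) = -log w / 2`, and the specific information is the divergence of `N(k v, w)` from `N(0, 1)`.

With `s = √(1 - ρ²)`, the residual variances of `X` and `Y` given `T` are `(b s / σ)²` and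
`(a s / σ)²`. As `a < b`, the target is more strongly correlated with `Y`, and the specific
information about every value `t` increases with the squared correlation
(`ae_minSpecificInfo_eq`). Hence the minimum is always `I_X(T)`, and `R^min = I(T;X)`.

For the pointwise decomposition, the residuals satisfy `a R_X + b R_Y = 0`, so the standardized
squared residuals agree, the two ambiguities differ by the constant `log (b / a)`, and their minimum
is the ambiguity of `Y`. The redundant specificity reduces to `𝔼 min (X², Y²)`; since `X - Y` and
`X + Y` are independent, `𝔼 |X² - Y²|` factorizes and equals `4 s / π`
(`IsNormalizedGaussianPair.integral_min_sq`).

Finally, `T` has no atoms and is a function of `(X, Y)`, so the joint law of `T` and `(X, Y)` is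
singular to the product of the marginals and `I(T;X,Y) = ∞` (`mutualInfo_eq_top_of_eq_comp`), which
makes both synergies infinite.
-/

open scoped NNReal

namespace PID

/-! ### Moments of the real Gaussian distribution -/

lemma integrable_id_gaussianReal (m : ℝ) (v : ℝ≥0) : Integrable (fun x ↦ x) (gaussianReal m v) :=
  (memLp_id_gaussianReal' 1 (by simp)).integrable le_rfl

lemma integrable_sq_gaussianReal (m : ℝ) (v : ℝ≥0) :
    Integrable (fun x ↦ x ^ 2) (gaussianReal m v) :=
  (memLp_id_gaussianReal' 2 (by simp)).integrable_sq

lemma integral_sq_gaussianReal (m : ℝ) (v : ℝ≥0) :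
    ∫ x, x ^ 2 ∂(gaussianReal m v) = v + m ^ 2 := by
  have h := variance_eq_sub (memLp_id_gaussianReal' (μ := m) (v := v) 2 (by simp))
  rw [variance_id_gaussianReal] at h
  simp only [Pi.pow_apply, id, integral_id_gaussianReal] at h
  linarith

lemma integral_sub_sq_gaussianReal (m : ℝ) (v : ℝ≥0) :
    ∫ x, (x - m) ^ 2 ∂(gaussianReal m v) = v := by
  have h := variance_id_gaussianReal (μ := m) (v := v)
  rw [variance_eq_integral (by fun_prop)] at h
  simpa [integral_id_gaussianReal] using h

lemma integrable_sub_sq_gaussianReal (m c : ℝ) (v : ℝ≥0) :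
    Integrable (fun x ↦ (x - c) ^ 2) (gaussianReal m v) :=
  ((memLp_id_gaussianReal' (μ := m) (v := v) 2 (by simp)).sub (memLp_const c)).integrable_sq

lemma integral_abs_gaussianReal (v : ℝ≥0) :
    ∫ x, |x| ∂(gaussianReal 0 v) = √(2 * v / Real.pi) := by
  rcases eq_or_ne v 0 with rfl | hv
  · simp
  have hv' : (0 : ℝ) < v := by positivity
  have hb : (0 : ℝ) < 1 / (2 * v) := by positivity
  rw [integral_gaussianReal_eq_integral_smul hv]
  have h1 (x : ℝ) : gaussianPDFReal 0 v x • |x|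
      = (√(2 * Real.pi * v))⁻¹ * (|x| * Real.exp (-(1 / (2 * v)) * |x| ^ 2)) := by
    simp only [gaussianPDFReal, smul_eq_mul, sub_zero, sq_abs]
    rw [show -x ^ 2 / (2 * v) = -(1 / (2 * (v : ℝ))) * x ^ 2 by ring]
    ring
  simp_rw [h1]
  rw [integral_const_mul,
    integral_comp_abs (f := fun x ↦ x * Real.exp (-(1 / (2 * v)) * x ^ 2))]
  have h2 := integral_rpow_mul_exp_neg_mul_rpow (p := 2) (q := 1) two_pos (by norm_num) hb
  norm_num at h2
  have h3 : ∫ x in Set.Ioi (0 : ℝ), x * Real.exp (-(1 / (2 * v)) * x ^ 2) = v := by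
    rw [show (∫ x in Set.Ioi (0 : ℝ), x * Real.exp (-(1 / (2 * v)) * x ^ 2))
      = ∫ x in Set.Ioi (0 : ℝ), x * Real.exp (-((v : ℝ)⁻¹ * (1 / 2) * x ^ 2)) by
        congr 1; ext x; congr 2; field_simp, h2, Real.rpow_neg_one]
    field_simp
  rw [h3, inv_mul_eq_div, div_eq_iff (by positivity), ← Real.sqrt_mul (by positivity),
    show 2 * v / Real.pi * (2 * Real.pi * v) = (2 * (v : ℝ)) ^ 2 by
      have := Real.pi_ne_zero; field_simp,
    Real.sqrt_sq (by positivity)]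

variable {Ω : Type*} [MeasurableSpace Ω] {P : Measure Ω} {X Y T U : Ω → ℝ} {ρ : ℝ}

lemma integrable_sq_of_map_eq {v : ℝ≥0} (hU : Measurable U) (h : P.map U = gaussianReal 0 v) :
    Integrable (fun ω ↦ U ω ^ 2) P := by
  refine Integrable.comp_measurable (g := fun x : ℝ ↦ x ^ 2) ?_ hU
  rw [h]
  exact integrable_sq_gaussianReal 0 v

lemma integral_sq_of_map_eq {v : ℝ≥0} (hU : Measurable U) (h : P.map U = gaussianReal 0 v) :
    ∫ ω, U ω ^ 2 ∂P = v := by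
  rw [← integral_map (f := fun x : ℝ ↦ x ^ 2) hU.aemeasurable (by fun_prop), h,
    integral_sq_gaussianReal]
  simp

/-! ### Linear combinations of a normalized Gaussian pair -/

/-- `multivariateGaussian` has the prescribed covariance only for positive semidefinite matrices;
for any other matrix it is a point mass by convention. -/
lemma posSemidef_correlation (hρ : ρ ∈ Set.Ioo (-1 : ℝ) 1) :
    (!![1, ρ; ρ, 1] : Matrix (Fin 2) (Fin 2) ℝ).PosSemidef := by
  refine Matrix.PosSemidef.of_dotProduct_mulVec_nonneg ?_ ?_
  · ext i j; fin_cases i <;> fin_cases j <;> simp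
  · intro x
    simp only [star_trivial, dotProduct, Matrix.mulVec, Fin.sum_univ_two, Matrix.of_apply,
      Matrix.cons_val', Matrix.cons_val_zero, Matrix.cons_val_one, Matrix.cons_val_fin_one]
    nlinarith [sq_nonneg (x 0 + ρ * x 1), mul_nonneg (sub_nonneg.2 (by nlinarith [hρ.1, hρ.2] :
      ρ ^ 2 ≤ 1)) (sq_nonneg (x 1))]

namespace IsNormalizedGaussianPair

lemma hasGaussianLaw_linComb (h : IsNormalizedGaussianPair P X Y ρ) (α β γ δ : ℝ) :
    HasGaussianLaw (fun ω ↦ (α * X ω + β * Y ω, γ * X ω + δ * Y ω)) P := by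
  have hG : HasGaussianLaw (fun ω ↦ !₂[X ω, Y ω]) P := by
    refine ⟨?_⟩
    rw [h]
    infer_instance
  let L : EuclideanSpace ℝ (Fin 2) →L[ℝ] ℝ × ℝ :=
    ContinuousLinearMap.prod (α • EuclideanSpace.proj 0 + β • EuclideanSpace.proj 1)
      (γ • EuclideanSpace.proj 0 + δ • EuclideanSpace.proj 1)
  simpa [L, Function.comp_def] using hG.map L

lemma hasLaw (h : IsNormalizedGaussianPair P X Y ρ) (hX : Measurable X) (hY : Measurable Y) :
    HasLaw (fun ω ↦ !₂[X ω, Y ω])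
      (multivariateGaussian (0 : EuclideanSpace ℝ (Fin 2)) !![1, ρ; ρ, 1]) P := by
  refine ⟨Measurable.aemeasurable ?_, h⟩
  refine (PiLp.continuous_toLp 2 _).measurable.comp (measurable_pi_iff.2 fun i ↦ ?_)
  fin_cases i <;> simpa

lemma covariance_coord (h : IsNormalizedGaussianPair P X Y ρ) (hX : Measurable X)
    (hY : Measurable Y) (hρ : ρ ∈ Set.Ioo (-1 : ℝ) 1) :
    cov[X, X; P] = 1 ∧ cov[X, Y; P] = ρ ∧ cov[Y, Y; P] = 1 := by
  have key (i j : Fin 2) := covariance_eval_multivariateGaussian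
    (μ := (0 : EuclideanSpace ℝ (Fin 2))) (posSemidef_correlation hρ) i j
  have key' (i j : Fin 2) := ((h.hasLaw hX hY).covariance_fun_comp (f := fun x ↦ x i)
    (g := fun x ↦ x j) (by fun_prop) (by fun_prop)).trans (key i j)
  exact ⟨by simpa using key' 0 0, by simpa using key' 0 1, by simpa using key' 1 1⟩

lemma integral_coord (h : IsNormalizedGaussianPair P X Y ρ) (hX : Measurable X)
    (hY : Measurable Y) (hρ : ρ ∈ Set.Ioo (-1 : ℝ) 1) :
    ∫ ω, X ω ∂P = 0 ∧ ∫ ω, Y ω ∂P = 0 := by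
  have key (i : Fin 2) := (((measurePreserving_eval_multivariateGaussian
    (μ := (0 : EuclideanSpace ℝ (Fin 2))) (posSemidef_correlation hρ) (i := i)).fun_comp_hasLaw
      (h.hasLaw hX hY)).integral_eq).trans integral_id_gaussianReal
  exact ⟨by simpa using key 0, by simpa using key 1⟩

lemma covariance_linComb [IsProbabilityMeasure P] (h : IsNormalizedGaussianPair P X Y ρ)
    (hX : Measurable X) (hY : Measurable Y) (hρ : ρ ∈ Set.Ioo (-1 : ℝ) 1) (α β γ δ : ℝ) :
    cov[fun ω ↦ α * X ω + β * Y ω, fun ω ↦ γ * X ω + δ * Y ω; P]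
      = α * γ + β * δ + ρ * (α * δ + β * γ) := by
  obtain ⟨hXX, hXY, hYY⟩ := h.covariance_coord hX hY hρ
  have h' := h.hasGaussianLaw_linComb 1 0 0 1
  simp only [one_mul, zero_mul, add_zero, zero_add] at h'
  have mX : MemLp X 2 P := h'.fst.memLp_two
  have mY : MemLp Y 2 P := h'.snd.memLp_two
  have e (α β : ℝ) : (fun ω ↦ α * X ω + β * Y ω) = α • X + β • Y := by ext; simp
  rw [e, e, covariance_add_left (mX.const_smul α) (mY.const_smul β)
    ((mX.const_smul γ).add (mY.const_smul δ)),
    covariance_add_right (mX.const_smul α) (mX.const_smul γ) (mY.const_smul δ),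
    covariance_add_right (mY.const_smul β) (mX.const_smul γ) (mY.const_smul δ)]
  simp only [covariance_smul_left, covariance_smul_right]
  rw [covariance_comm Y X, hXX, hXY, hYY]
  ring

lemma map_linComb [IsProbabilityMeasure P] (h : IsNormalizedGaussianPair P X Y ρ)
    (hX : Measurable X) (hY : Measurable Y) (hρ : ρ ∈ Set.Ioo (-1 : ℝ) 1) (α β : ℝ) :
    P.map (fun ω ↦ α * X ω + β * Y ω)
      = gaussianReal 0 (α ^ 2 + β ^ 2 + 2 * ρ * α * β).toNNReal := by
  have hG := (h.hasGaussianLaw_linComb α β α β).fst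
  have h' := h.hasGaussianLaw_linComb 1 0 0 1
  simp only [one_mul, zero_mul, add_zero, zero_add] at h'
  rw [hG.map_eq_gaussianReal, ← covariance_self hG.aemeasurable, h.covariance_linComb hX hY hρ,
    integral_add (h'.fst.integrable.const_mul α) (h'.snd.integrable.const_mul β),
    integral_const_mul, integral_const_mul, (h.integral_coord hX hY hρ).1,
    (h.integral_coord hX hY hρ).2]
  congr 1
  · ring
  · congr 1; ring

lemma indepFun_linComb [IsProbabilityMeasure P] (h : IsNormalizedGaussianPair P X Y ρ)
    (hX : Measurable X) (hY : Measurable Y) (hρ : ρ ∈ Set.Ioo (-1 : ℝ) 1) {α β γ δ : ℝ}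
    (h0 : α * γ + β * δ + ρ * (α * δ + β * γ) = 0) :
    IndepFun (fun ω ↦ α * X ω + β * Y ω) (fun ω ↦ γ * X ω + δ * Y ω) P :=
  (h.hasGaussianLaw_linComb α β γ δ).indepFun_of_covariance_eq_zero
    ((h.covariance_linComb hX hY hρ α β γ δ).trans h0)

end IsNormalizedGaussianPair

/-! ### Gaussian regression -/

/-- `U = k T + R`, where `T` and the residual `R` are independent centred Gaussian variables with
variances `τ` and `w`; the variance of `U` is recorded as `v`, and no variance vanishes. -/
structure IsGaussianRegression (P : Measure Ω) (T U : Ω → ℝ) (k : ℝ) (τ v w : ℝ≥0) : Prop where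
  measurable_left : Measurable T
  measurable_right : Measurable U
  left_ne : τ ≠ 0
  right_ne : v ≠ 0
  residual_ne : w ≠ 0
  map_left : P.map T = gaussianReal 0 τ
  map_right : P.map U = gaussianReal 0 v
  map_residual : P.map (fun ω ↦ U ω - k * T ω) = gaussianReal 0 w
  indepFun : IndepFun T (fun ω ↦ U ω - k * T ω) P

lemma log_gaussianPDFReal (m : ℝ) {v : ℝ≥0} (hv : v ≠ 0) (x : ℝ) :
    Real.log (gaussianPDFReal m v x)
      = -(Real.log (2 * Real.pi * v) / 2) - (x - m) ^ 2 / (2 * v) := by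
  have hv' : (0 : ℝ) < v := by positivity
  rw [gaussianPDFReal, Real.log_mul (by positivity) (by positivity), Real.log_inv, Real.log_exp,
    Real.log_sqrt (by positivity)]
  ring

lemma log_gaussianPDFReal_div (m m' : ℝ) {v w : ℝ≥0} (hv : v ≠ 0) (hw : w ≠ 0) (x : ℝ) :
    Real.log (gaussianPDFReal m w x / gaussianPDFReal m' v x)
      = Real.log (v / w) / 2 - (x - m) ^ 2 / (2 * w) + (x - m') ^ 2 / (2 * v) := by
  have hv' : (0 : ℝ) < v := by positivity
  have hw' : (0 : ℝ) < w := by positivity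
  rw [Real.log_div (gaussianPDFReal_pos _ _ _ hw).ne' (gaussianPDFReal_pos _ _ _ hv).ne',
    log_gaussianPDFReal _ hw, log_gaussianPDFReal _ hv, Real.log_div hv'.ne' hw'.ne',
    Real.log_mul (by positivity) hv'.ne', Real.log_mul (by positivity) hw'.ne']
  ring

lemma measurable_gaussianPDF_regression (k : ℝ) (w : ℝ≥0) :
    Measurable (fun p : ℝ × ℝ ↦ gaussianPDF (k * p.1) w p.2) :=
  measurable_uncurry_gaussianPDF.comp
    (f := fun p : ℝ × ℝ ↦ (k * p.1, w, p.2)) (by fun_prop)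

/-- As `dens` comes from a Radon–Nikodym derivative, it equals the Gaussian density only almost
everywhere. -/
lemma dens_ae_eq {m : ℝ} {v : ℝ≥0} [IsFiniteMeasure P] (hU : Measurable U) (hv : v ≠ 0)
    (h : P.map U = gaussianReal m v) :
    HasPDF U P volume ∧ dens P U =ᵐ[volume] gaussianPDFReal m v := by
  have hpdf : HasPDF U P volume :=
    (Real.hasPDF_iff_of_aemeasurable hU.aemeasurable).2
      (h ▸ gaussianReal_absolutelyContinuous m hv)
  refine ⟨hpdf, ?_⟩
  have h' := (pdf.eq_of_map_eq_withDensity (X := U) _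
    (measurable_gaussianPDF m v).aemeasurable).1 (h.trans (gaussianReal_of_var_ne_zero m hv))
  filter_upwards [h'] with x hx
  rw [dens, hx, toReal_gaussianPDF]

namespace IsGaussianRegression

variable {k : ℝ} {τ v w : ℝ≥0}

/-- The law of `(T, U)` is the image of the product law of `(T, U - k T)` under a shear, which
preserves Lebesgue measure. -/
lemma map_prodMk [IsProbabilityMeasure P] (h : IsGaussianRegression P T U k τ v w) :
    P.map (fun ω ↦ (T ω, U ω)) = (volume : Measure (ℝ × ℝ)).withDensity
      (fun p ↦ gaussianPDF 0 τ p.1 * gaussianPDF (k * p.1) w p.2) := by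
  have hT := h.measurable_left
  have hU := h.measurable_right
  have hR : Measurable fun ω ↦ U ω - k * T ω := by fun_prop
  have hprod : P.map (fun ω ↦ (T ω, U ω - k * T ω))
      = (volume : Measure (ℝ × ℝ)).withDensity
        (fun p ↦ gaussianPDF 0 τ p.1 * gaussianPDF 0 w p.2) := by
    rw [(indepFun_iff_map_prod_eq_prod_map_map hT.aemeasurable hR.aemeasurable).1 h.indepFun,
      h.map_left, h.map_residual, gaussianReal_of_var_ne_zero _ h.left_ne,
      gaussianReal_of_var_ne_zero _ h.residual_ne,
      prod_withDensity (measurable_gaussianPDF _ _) (measurable_gaussianPDF _ _),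
      ← Measure.volume_eq_prod]
  have hm := measurable_gaussianPDF_regression k w
  have hm0 := measurable_gaussianPDF 0 τ
  have hmw := measurable_gaussianPDF 0 w
  refine Measure.ext_of_lintegral _ fun f hf ↦ ?_
  have hcomp : P.map (fun ω ↦ (T ω, U ω))
      = (P.map (fun ω ↦ (T ω, U ω - k * T ω))).map (fun p ↦ (p.1, p.2 + k * p.1)) := by
    rw [Measure.map_map (by fun_prop) (by fun_prop)]
    simp [Function.comp_def]
  rw [hcomp, lintegral_map hf (by fun_prop), hprod,
    lintegral_withDensity_eq_lintegral_mul _ (by fun_prop) (by fun_prop),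
    lintegral_withDensity_eq_lintegral_mul _ (by fun_prop) hf,
    Measure.volume_eq_prod, lintegral_prod _ (by fun_prop), lintegral_prod _ (by fun_prop)]
  refine lintegral_congr fun t ↦ ?_
  rw [← lintegral_sub_right_eq_self _ (k * t)]
  refine lintegral_congr fun u ↦ ?_
  simp [gaussianPDF, gaussianPDFReal_sub]

lemma map_prodMk_swap [IsProbabilityMeasure P] (h : IsGaussianRegression P T U k τ v w) :
    P.map (fun ω ↦ (U ω, T ω)) = (volume : Measure (ℝ × ℝ)).withDensity
      (fun p ↦ gaussianPDF 0 τ p.2 * gaussianPDF (k * p.2) w p.1) := by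
  have hT := h.measurable_left
  have hU := h.measurable_right
  have hm := measurable_gaussianPDF_regression k w
  have hm0 := measurable_gaussianPDF 0 τ
  have hm' := hm.comp measurable_swap
  simp only [Function.comp_def, Prod.fst_swap, Prod.snd_swap] at hm'
  have hcomp : P.map (fun ω ↦ (U ω, T ω)) = (P.map (fun ω ↦ (T ω, U ω))).map Prod.swap := by
    rw [Measure.map_map measurable_swap (by fun_prop)]
    simp [Function.comp_def]
  refine Measure.ext_of_lintegral _ fun f hf ↦ ?_
  rw [hcomp, lintegral_map hf measurable_swap, h.map_prodMk,
    lintegral_withDensity_eq_lintegral_mul _ (by fun_prop) (g := fun p : ℝ × ℝ ↦ f p.swap)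
      (hf.comp measurable_swap),
    lintegral_withDensity_eq_lintegral_mul _ (by fun_prop) hf,
    Measure.volume_eq_prod, ← lintegral_prod_swap]
  rfl

lemma jointDens_ae_eq [IsProbabilityMeasure P] (h : IsGaussianRegression P T U k τ v w) :
    HasPDF (fun ω ↦ (U ω, T ω)) P volume ∧
      ∀ᵐ p : ℝ × ℝ, jointDens P U T p.1 p.2
        = gaussianPDFReal 0 τ p.2 * gaussianPDFReal (k * p.2) w p.1 := by
  have hT := h.measurable_left
  have hU := h.measurable_right
  have hm' := (measurable_gaussianPDF_regression k w).comp measurable_swap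
  simp only [Function.comp_def, Prod.fst_swap, Prod.snd_swap] at hm'
  have hm0 := measurable_gaussianPDF 0 τ
  have hpdf : HasPDF (fun ω ↦ (U ω, T ω)) P volume := by
    rw [hasPDF_iff]
    refine ⟨by fun_prop, inferInstance, ?_⟩
    rw [h.map_prodMk_swap]
    exact withDensity_absolutelyContinuous _ _
  refine ⟨hpdf, ?_⟩
  have h' := (pdf.eq_of_map_eq_withDensity (X := fun ω ↦ (U ω, T ω))
    (fun p : ℝ × ℝ ↦ gaussianPDF 0 τ p.2 * gaussianPDF (k * p.2) w p.1)
    (by fun_prop)).1 h.map_prodMk_swap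
  filter_upwards [h'] with p hp
  rw [jointDens, Prod.mk.eta, hp, ENNReal.toReal_mul, toReal_gaussianPDF, toReal_gaussianPDF]

lemma ae_condDens_eq [IsProbabilityMeasure P] (h : IsGaussianRegression P T U k τ v w) :
    ∀ᵐ ω ∂P, condDens P U T (U ω) (T ω) = gaussianPDFReal (k * T ω) w (U ω) := by
  have hT := h.measurable_left
  have hU := h.measurable_right
  obtain ⟨hpdf, hj⟩ := h.jointDens_ae_eq
  obtain ⟨hpdfT, hd⟩ := dens_ae_eq hT h.left_ne h.map_left
  have h1 := ae_of_ae_map (by fun_prop) (hpdf.absolutelyContinuous'.ae_le hj)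
  have h2 := ae_of_ae_map (by fun_prop) (hpdfT.absolutelyContinuous'.ae_le hd)
  filter_upwards [h1, h2] with ω h1 h2
  rw [condDens, h1, h2, mul_div_cancel_left₀ _ (gaussianPDFReal_pos _ _ _ h.left_ne).ne']

lemma ae_ptAmbiguity_eq [IsProbabilityMeasure P] (h : IsGaussianRegression P T U k τ v w) :
    ∀ᵐ ω ∂P, ptAmbiguity P T U ω
      = Real.log (2 * Real.pi * w) / 2 + (U ω - k * T ω) ^ 2 / (2 * w) := by
  filter_upwards [h.ae_condDens_eq] with ω hω
  rw [ptAmbiguity, hω, log_gaussianPDFReal _ h.residual_ne]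
  ring

lemma integrable_residual_sq (h : IsGaussianRegression P T U k τ v w) :
    Integrable (fun ω ↦ (U ω - k * T ω) ^ 2) P ∧ ∫ ω, (U ω - k * T ω) ^ 2 ∂P = w := by
  have hR : Measurable fun ω ↦ U ω - k * T ω :=
    h.measurable_right.sub (h.measurable_left.const_mul k)
  exact ⟨integrable_sq_of_map_eq hR h.map_residual, integral_sq_of_map_eq hR h.map_residual⟩

lemma integrable_ptAmbiguity [IsProbabilityMeasure P] (h : IsGaussianRegression P T U k τ v w) :
    Integrable (ptAmbiguity P T U) P :=
  ((integrable_const _).add (h.integrable_residual_sq.1.div_const _)).congr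
    (h.ae_ptAmbiguity_eq.mono fun _ hω ↦ hω.symm)

lemma ambiguity_eq [IsProbabilityMeasure P] (h : IsGaussianRegression P T U k τ v w) :
    ambiguity P T U = Real.log (2 * Real.pi * w) / 2 + 1 / 2 := by
  have hw : (w : ℝ) ≠ 0 := by exact_mod_cast h.residual_ne
  rw [ambiguity, integral_congr_ae h.ae_ptAmbiguity_eq,
    integral_add (integrable_const _) (h.integrable_residual_sq.1.div_const _), integral_const,
    integral_div,
    h.integrable_residual_sq.2]
  simp
  field_simp

/-- For almost every value `t` of `T`, the specific information is the Kullback–Leibler divergence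
of the conditional law `N(kt, w)` of `U` from its marginal law `N(0, v)`. -/
lemma ae_specificInfo_eq [IsProbabilityMeasure P] (h : IsGaussianRegression P T U k τ v w) :
    ∀ᵐ t ∂(P.map T), Integrable (specificIntegrand P T U t) volume ∧
      specificInfo P T U t
        = Real.log (v / w) / 2 - 1 / 2 + (w + (k * t) ^ 2) / (2 * v) := by
  have hw : (w : ℝ) ≠ 0 := by exact_mod_cast h.residual_ne
  obtain ⟨-, hj⟩ := h.jointDens_ae_eq
  obtain ⟨hpdfT, hdT⟩ := dens_ae_eq h.measurable_left h.left_ne h.map_left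
  obtain ⟨-, hdU⟩ := dens_ae_eq h.measurable_right h.right_ne h.map_right
  have hj' : ∀ᵐ t : ℝ, ∀ᵐ u : ℝ, jointDens P U T u t
      = gaussianPDFReal 0 τ t * gaussianPDFReal (k * t) w u := by
    rw [Measure.volume_eq_prod] at hj
    exact Measure.ae_ae_of_ae_prod
      ((Measure.measurePreserving_swap (μ := (volume : Measure ℝ))
        (ν := (volume : Measure ℝ))).quasiMeasurePreserving.ae hj)
  filter_upwards [hpdfT.absolutelyContinuous'.ae_le hj', hpdfT.absolutelyContinuous'.ae_le hdT]
    with t ht hdt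
  have hae : specificIntegrand P T U t =ᵐ[volume] fun u ↦ gaussianPDFReal (k * t) w u •
      (Real.log (v / w) / 2 - (u - k * t) ^ 2 / (2 * w) + u ^ 2 / (2 * v)) := by
    filter_upwards [ht, hdU] with u hu hdu
    have hτ := (gaussianPDFReal_pos 0 τ t h.left_ne).ne'
    rw [specificIntegrand, condDens, hu, hdt, hdu, mul_div_cancel_left₀ _ hτ,
      mul_comm (gaussianPDFReal 0 v u), mul_div_mul_left _ _ hτ,
      log_gaussianPDFReal_div _ _ h.right_ne h.residual_ne, sub_zero, smul_eq_mul]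
  have i1 := integrable_sub_sq_gaussianReal (k * t) (k * t) w
  have i2 := integrable_sq_gaussianReal (k * t) w
  have i3 : Integrable (fun u : ℝ ↦ Real.log (v / w) / 2 - (u - k * t) ^ 2 / (2 * w))
    (gaussianReal (k * t) w) := (integrable_const _).sub (i1.div_const _)
  constructor
  · refine Integrable.congr ?_ hae.symm
    have := i3.add (i2.div_const (2 * (v : ℝ)))
    rw [gaussianReal_of_var_ne_zero _ h.residual_ne,
      integrable_withDensity_iff_integrable_smul' (measurable_gaussianPDF _ _)
        (Filter.Eventually.of_forall fun _ ↦ gaussianPDF_lt_top)] at this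
    simpa only [toReal_gaussianPDF, Pi.add_apply] using this
  · rw [specificInfo, integral_congr_ae hae,
      ← integral_gaussianReal_eq_integral_smul h.residual_ne,
      integral_add i3 (i2.div_const _), integral_sub (integrable_const _) (i1.div_const _),
      integral_const, integral_div, integral_div, integral_sub_sq_gaussianReal,
      integral_sq_gaussianReal]
    simp
    field_simp

/-- The log-likelihood ratio of the joint law with respect to the product of the marginals is
`log (v / w) / 2 - (u - k t)² / (2 w) + u² / (2 v)`, and the two quadratic terms have expectations
`-1/2` and `1/2`. -/
lemma mutualInfo_eq [IsProbabilityMeasure P] (h : IsGaussianRegression P T U k τ v w) :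
    (mutualInfo P T U : EReal) = ((Real.log (v / w) / 2 : ℝ) : EReal) := by
  have hT := h.measurable_left
  have hU := h.measurable_right
  have hw : (w : ℝ) ≠ 0 := by exact_mod_cast h.residual_ne
  have hv : (v : ℝ) ≠ 0 := by exact_mod_cast h.right_ne
  set μ := P.map (fun ω ↦ (T ω, U ω)) with hμ
  set ν := (P.map T).prod (P.map U) with hν
  have : IsProbabilityMeasure μ := Measure.isProbabilityMeasure_map (by fun_prop)
  have : IsProbabilityMeasure (P.map T) := Measure.isProbabilityMeasure_map (by fun_prop)
  have : IsProbabilityMeasure (P.map U) := Measure.isProbabilityMeasure_map (by fun_prop)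
  have hm := measurable_gaussianPDF_regression k w
  have hm0 := measurable_gaussianPDF 0 τ
  have hmv := measurable_gaussianPDF 0 v
  let r : ℝ × ℝ → ℝ≥0∞ := fun p ↦ gaussianPDF (k * p.1) w p.2 / gaussianPDF 0 v p.2
  have hr : Measurable r := by fun_prop
  have hμν : μ = ν.withDensity r := by
    rw [hν, h.map_left, h.map_right, gaussianReal_of_var_ne_zero _ h.left_ne,
      gaussianReal_of_var_ne_zero _ h.right_ne, prod_withDensity hm0 hmv,
      ← Measure.volume_eq_prod, ← withDensity_mul _ (by fun_prop) hr, hμ, h.map_prodMk]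
    congr 1
    ext p
    simp only [Pi.mul_apply, r]
    rw [mul_assoc, ENNReal.mul_div_cancel (gaussianPDF_pos _ h.right_ne _).ne' gaussianPDF_ne_top]
  have hac : μ ≪ ν := hμν ▸ withDensity_absolutelyContinuous _ _
  have hllr : llr μ ν =ᵐ[μ] fun p ↦ Real.log (v / w) / 2
      - (p.2 - k * p.1) ^ 2 / (2 * w) + p.2 ^ 2 / (2 * v) := by
    have h1 : μ.rnDeriv ν =ᵐ[ν] r := hμν ▸ Measure.rnDeriv_withDensity ν hr
    filter_upwards [hac.ae_le h1] with p hp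
    rw [llr, hp, ENNReal.toReal_div, toReal_gaussianPDF, toReal_gaussianPDF,
      log_gaussianPDFReal_div _ _ h.right_ne h.residual_ne, sub_zero]
  have iU := integrable_sq_of_map_eq hU h.map_right
  have eU := integral_sq_of_map_eq hU h.map_right
  obtain ⟨iR, eR⟩ := h.integrable_residual_sq
  have i3 : Integrable (fun ω ↦ Real.log (v / w) / 2 - (U ω - k * T ω) ^ 2 / (2 * w)) P :=
    (integrable_const _).sub (iR.div_const _)
  have hint : Integrable (llr μ ν) μ := by
    rw [integrable_congr hllr, hμ, integrable_map_measure (by fun_prop) (by fun_prop)]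
    exact i3.add (iU.div_const _)
  have hval : ∫ p, llr μ ν p ∂μ = Real.log (v / w) / 2 := by
    rw [integral_congr_ae hllr, hμ, integral_map (by fun_prop) (by fun_prop),
      integral_add i3 (iU.div_const _), integral_sub (integrable_const _) (iR.div_const _),
      integral_const, integral_div, integral_div, eR, eU]
    simp
    field_simp
    ring
  have hne : mutualInfo P T U ≠ ∞ := InformationTheory.klDiv_ne_top hac hint
  rw [← EReal.coe_toReal (x := (mutualInfo P T U : EReal)) (by simpa using hne) (by simp),
    EReal.toReal_coe_ennreal, mutualInfo,
    InformationTheory.toReal_klDiv_of_measure_eq hac (by simp), hval]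

end IsGaussianRegression

/-! ### Expectations of specificity, ambiguity and specific information -/

lemma ae_ptSpecificity_eq {v : ℝ≥0} [IsProbabilityMeasure P] (hU : Measurable U) (hv : v ≠ 0)
    (h : P.map U = gaussianReal 0 v) :
    ∀ᵐ ω ∂P, ptSpecificity P U ω = Real.log (2 * Real.pi * v) / 2 + U ω ^ 2 / (2 * v) := by
  obtain ⟨hpdf, hd⟩ := dens_ae_eq hU hv h
  filter_upwards [ae_of_ae_map hU.aemeasurable (hpdf.absolutelyContinuous'.ae_le hd)] with ω hω
  rw [ptSpecificity, hω, log_gaussianPDFReal _ hv]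
  ring

lemma integrable_ptSpecificity {v : ℝ≥0} [IsProbabilityMeasure P] (hU : Measurable U)
    (hv : v ≠ 0) (h : P.map U = gaussianReal 0 v) : Integrable (ptSpecificity P U) P :=
  ((integrable_const _).add ((integrable_sq_of_map_eq hU h).div_const _)).congr
    ((ae_ptSpecificity_eq hU hv h).mono fun _ hω ↦ hω.symm)

lemma specificity_eq {v : ℝ≥0} [IsProbabilityMeasure P] (hU : Measurable U)
    (hv : v ≠ 0) (h : P.map U = gaussianReal 0 v) :
    specificity P U = Real.log (2 * Real.pi * v) / 2 + 1 / 2 := by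
  have hv' : (v : ℝ) ≠ 0 := by exact_mod_cast hv
  rw [specificity, integral_congr_ae (ae_ptSpecificity_eq hU hv h),
    integral_add (integrable_const _) ((integrable_sq_of_map_eq hU h).div_const _),
    integral_const, integral_div, integral_sq_of_map_eq hU h]
  simp
  field_simp

namespace IsGaussianRegression

variable {k : ℝ} {τ v w : ℝ≥0}

lemma ae_specificInfo_comp_eq [IsProbabilityMeasure P] (h : IsGaussianRegression P T U k τ v w) :
    ∀ᵐ ω ∂P, specificInfo P T U (T ω)
      = Real.log (v / w) / 2 - 1 / 2 + (w + (k * T ω) ^ 2) / (2 * v) :=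
  ae_of_ae_map h.measurable_left.aemeasurable (h.ae_specificInfo_eq.mono fun _ ht ↦ ht.2)

lemma integrable_specificInfo [IsProbabilityMeasure P] (h : IsGaussianRegression P T U k τ v w) :
    Integrable (fun ω ↦ specificInfo P T U (T ω)) P := by
  have i := integrable_sq_of_map_eq h.measurable_left h.map_left
  refine Integrable.congr ?_ (h.ae_specificInfo_comp_eq.mono fun _ hω ↦ hω.symm)
  simp only [mul_pow]
  exact (integrable_const _).add (((integrable_const _).add (i.const_mul _)).div_const _)

lemma integral_specificInfo [IsProbabilityMeasure P] (h : IsGaussianRegression P T U k τ v w) :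
    ∫ ω, specificInfo P T U (T ω) ∂P
      = Real.log (v / w) / 2 - 1 / 2 + (w + k ^ 2 * τ) / (2 * v) := by
  have i := integrable_sq_of_map_eq h.measurable_left h.map_left
  rw [integral_congr_ae h.ae_specificInfo_comp_eq]
  simp only [mul_pow]
  have i' : Integrable (fun ω ↦ ((w : ℝ) + k ^ 2 * T ω ^ 2) / (2 * v)) P :=
    ((integrable_const _).add (i.const_mul _)).div_const _
  rw [integral_add (integrable_const _) i',
    integral_const, integral_div, integral_add (integrable_const _) (i.const_mul _),
    integral_const, integral_const_mul, integral_sq_of_map_eq h.measurable_left h.map_left]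
  simp

end IsGaussianRegression

/-- A variable without atoms that is a function of `V` shares infinitely much information with `V`:
the joint law lives on the graph of the function, which is null for the product of the marginals. -/
lemma mutualInfo_eq_top_of_eq_comp {β : Type*} [MeasurableSpace β] [IsProbabilityMeasure P]
    {V : Ω → β} {f : β → ℝ} (hV : Measurable V) (hf : Measurable f) (hT : ∀ ω, T ω = f (V ω))
    (hatom : ∀ t, P.map T {t} = 0) : mutualInfo P T V = ∞ := by
  obtain rfl : T = f ∘ V := funext hT
  have hTm : Measurable (f ∘ V) := hf.comp hV
  have : IsProbabilityMeasure (P.map (f ∘ V)) := Measure.isProbabilityMeasure_map (by fun_prop)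
  have : IsProbabilityMeasure (P.map V) := Measure.isProbabilityMeasure_map (by fun_prop)
  refine InformationTheory.klDiv_of_not_ac fun hac ↦ ?_
  have hA : MeasurableSet {p : ℝ × β | p.1 = f p.2} :=
    measurableSet_eq_fun measurable_fst (hf.comp measurable_snd)
  have h0 : (P.map (f ∘ V)).prod (P.map V) {p : ℝ × β | p.1 = f p.2} = 0 := by
    rw [Measure.prod_apply_symm hA]
    simp only [Set.preimage_ofPred_eq, Set.ofPred_eq_eq_singleton, hatom, lintegral_zero]
  have h1 := hac h0
  rw [Measure.map_apply (by fun_prop) hA] at h1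
  simp at h1

/-! ### Gaussian pairs with linear target -/

namespace IsNormalizedGaussianPair

lemma isGaussianRegression [IsProbabilityMeasure P] (h : IsNormalizedGaussianPair P X Y ρ)
    (hX : Measurable X) (hY : Measurable Y) (hρ : ρ ∈ Set.Ioo (-1 : ℝ) 1)
    {α β γ δ k τ v w : ℝ} (hT : ∀ ω, T ω = α * X ω + β * Y ω)
    (hU : ∀ ω, U ω = γ * X ω + δ * Y ω) (hτ : 0 < τ) (hv : 0 < v) (hw : 0 < w)
    (hτ' : α ^ 2 + β ^ 2 + 2 * ρ * α * β = τ) (hv' : γ ^ 2 + δ ^ 2 + 2 * ρ * γ * δ = v)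
    (hk : k * τ = α * γ + β * δ + ρ * (α * δ + β * γ)) (hw' : w = v - k ^ 2 * τ) :
    IsGaussianRegression P T U k τ.toNNReal v.toNNReal w.toNNReal := by
  obtain rfl : T = fun ω ↦ α * X ω + β * Y ω := funext hT
  obtain rfl : U = fun ω ↦ γ * X ω + δ * Y ω := funext hU
  have hR : (fun ω ↦ γ * X ω + δ * Y ω - k * (α * X ω + β * Y ω))
      = fun ω ↦ (γ - k * α) * X ω + (δ - k * β) * Y ω := by
    ext ω; ring
  refine ⟨by fun_prop, by fun_prop, by simpa, by simpa, by simpa, ?_, ?_, ?_, ?_⟩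
  · rw [h.map_linComb hX hY hρ, hτ']
  · rw [h.map_linComb hX hY hρ, hv']
  · rw [hR, h.map_linComb hX hY hρ]
    congr 2
    linear_combination k ^ 2 * hτ' + hv' - hw' + 2 * k * hk
  · rw [hR]
    exact h.indepFun_linComb hX hY hρ (by linear_combination -hk - k * hτ')

/-- The expectation follows from `min (x², y²) = (x² + y² - |x - y| |x + y|) / 2`, since `X - Y`
and `X + Y` are independent. -/
lemma integral_min_sq [IsProbabilityMeasure P] (h : IsNormalizedGaussianPair P X Y ρ)
    (hX : Measurable X) (hY : Measurable Y) (hρ : ρ ∈ Set.Ioo (-1 : ℝ) 1)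
    (hlX : P.map X = gaussianReal 0 1) (hlY : P.map Y = gaussianReal 0 1) :
    ∫ ω, min (X ω ^ 2) (Y ω ^ 2) ∂P = 1 - 2 * √(1 - ρ ^ 2) / Real.pi := by
  have hind := h.indepFun_linComb hX hY hρ (α := 1) (β := -1) (γ := 1) (δ := 1) (by ring)
  have hm := h.map_linComb hX hY hρ 1 (-1)
  have hp := h.map_linComb hX hY hρ 1 1
  have hmm : Measurable fun ω ↦ 1 * X ω + -1 * Y ω := by fun_prop
  have hpm : Measurable fun ω ↦ 1 * X ω + 1 * Y ω := by fun_prop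
  have e (x y : ℝ) : min (x ^ 2) (y ^ 2)
      = (x ^ 2 + y ^ 2 - |1 * x + -1 * y| * |1 * x + 1 * y|) / 2 := by
    rw [← abs_mul, show (1 * x + -1 * y) * (1 * x + 1 * y) = x ^ 2 - y ^ 2 by ring]
    rcases le_total (x ^ 2) (y ^ 2) with h | h
    · rw [min_eq_left h, abs_of_nonpos (by linarith)]; ring
    · rw [min_eq_right h, abs_of_nonneg (by linarith)]; ring
  have ind' : IndepFun (fun ω ↦ |1 * X ω + -1 * Y ω|) (fun ω ↦ |1 * X ω + 1 * Y ω|) P :=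
    hind.comp (φ := fun x : ℝ ↦ |x|) (ψ := fun x : ℝ ↦ |x|) (by fun_prop) (by fun_prop)
  have iabs {V : Ω → ℝ} {v : ℝ≥0} (hV : Measurable V) (hl : P.map V = gaussianReal 0 v) :
      Integrable (fun ω ↦ |V ω|) P ∧ ∫ ω, |V ω| ∂P = √(2 * v / Real.pi) := by
    refine ⟨Integrable.comp_measurable (g := fun x : ℝ ↦ |x|) ?_ hV, ?_⟩
    · rw [hl]; exact (integrable_id_gaussianReal 0 v).abs
    · rw [← integral_map (f := fun x : ℝ ↦ |x|) hV.aemeasurable (by fun_prop), hl,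
        integral_abs_gaussianReal]
  have im := iabs hmm hm
  have ip := iabs hpm hp
  have iX := integrable_sq_of_map_eq hX hlX
  have iY := integrable_sq_of_map_eq hY hlY
  have iXY : Integrable (fun ω ↦ X ω ^ 2 + Y ω ^ 2) P := iX.add iY
  simp_rw [e]
  have iprod : Integrable (fun ω ↦ |1 * X ω + -1 * Y ω| * |1 * X ω + 1 * Y ω|) P :=
    ind'.integrable_mul im.1 ip.1
  have eprod : ∫ ω, |1 * X ω + -1 * Y ω| * |1 * X ω + 1 * Y ω| ∂P
      = (∫ ω, |1 * X ω + -1 * Y ω| ∂P) * ∫ ω, |1 * X ω + 1 * Y ω| ∂P :=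
    ind'.integral_fun_mul_eq_mul_integral im.1.aestronglyMeasurable ip.1.aestronglyMeasurable
  rw [integral_div, integral_sub iXY iprod, integral_add iX iY,
    integral_sq_of_map_eq hX hlX, integral_sq_of_map_eq hY hlY, eprod, im.2, ip.2]
  have h1 : 0 < 1 - ρ := by linarith [hρ.2]
  have h2 : 0 < 1 + ρ := by linarith [hρ.1]
  rw [Real.coe_toNNReal _ (by linarith), Real.coe_toNNReal _ (by linarith),
    ← Real.sqrt_mul (by have := Real.pi_pos; apply div_nonneg <;> linarith)]
  rw [show 2 * (1 ^ 2 + (-1) ^ 2 + 2 * ρ * 1 * -1) / Real.pi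
      * (2 * (1 ^ 2 + 1 ^ 2 + 2 * ρ * 1 * 1) / Real.pi) = (4 / Real.pi) ^ 2 * (1 - ρ ^ 2) by ring,
    Real.sqrt_mul (by positivity), Real.sqrt_sq (by have := Real.pi_pos; positivity)]
  push_cast
  ring

end IsNormalizedGaussianPair

/-- Under standard Gaussian marginals, both specificities have the same constant
term, so that their minimum is governed by the minimum of the squares. -/
lemma redSpecificity_eq [IsProbabilityMeasure P] (hX : Measurable X) (hY : Measurable Y)
    (hlX : P.map X = gaussianReal 0 1) (hlY : P.map Y = gaussianReal 0 1) :
    redSpecificity P X Y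
      = Real.log (2 * Real.pi) / 2 + (∫ ω, min (X ω ^ 2) (Y ω ^ 2) ∂P) / 2 := by
  have iX := integrable_sq_of_map_eq hX hlX
  have iY := integrable_sq_of_map_eq hY hlY
  have imin : Integrable (fun ω ↦ min (X ω ^ 2) (Y ω ^ 2)) P := iX.inf iY
  have hae : (fun ω ↦ min (ptSpecificity P X ω) (ptSpecificity P Y ω)) =ᵐ[P]
      fun ω ↦ Real.log (2 * Real.pi) / 2 + min (X ω ^ 2) (Y ω ^ 2) / 2 := by
    filter_upwards [ae_ptSpecificity_eq hX one_ne_zero hlX,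
      ae_ptSpecificity_eq hY one_ne_zero hlY] with ω h1 h2
    rw [h1, h2, min_add_add_left]
    simp only [NNReal.coe_one, mul_one]
    rw [min_div_div_right zero_le_two]
  rw [redSpecificity, integral_congr_ae hae,
    integral_add (integrable_const _) (imin.div_const _), integral_const, integral_div]
  simp

/-- The specific information increases with the squared correlation at every value of the target,
because `-log w - (1 - w)` decreases in the residual variance `w` on `(0, 1]`. -/
lemma ae_minSpecificInfo_eq [IsProbabilityMeasure P] {k k' : ℝ} {τ w w' : ℝ≥0}
    (h : IsGaussianRegression P T X k τ 1 w) (h' : IsGaussianRegression P T Y k' τ 1 w')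
    (hw : w' ≤ w) (hw1 : w ≤ 1) (hk : k ^ 2 ≤ k' ^ 2) :
    minSpecificInfo P T X Y =ᵐ[P] fun ω ↦ specificInfo P T X (T ω) := by
  have hwp : (0 : ℝ) < w := by exact_mod_cast pos_iff_ne_zero.2 h.residual_ne
  have hwp' : (0 : ℝ) < w' := by exact_mod_cast pos_iff_ne_zero.2 h'.residual_ne
  have hw_le : (w' : ℝ) ≤ w := by exact_mod_cast hw
  have hw_one : (w : ℝ) ≤ 1 := by exact_mod_cast hw1
  filter_upwards [h.ae_specificInfo_comp_eq, h'.ae_specificInfo_comp_eq] with ω h1 h2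
  refine min_eq_left ?_
  rw [h1, h2]
  simp only [NNReal.coe_one, one_div, Real.log_inv, mul_one, mul_pow]
  have hlog : (w : ℝ) - w' ≤ Real.log w - Real.log w' := by
    rw [← Real.log_div hwp.ne' hwp'.ne']
    refine le_trans ?_ (Real.one_sub_inv_le_log_of_pos (by positivity))
    rw [inv_div, one_sub_div hwp.ne', le_div_iff₀ hwp]
    nlinarith
  have := mul_le_mul_of_nonneg_right hk (sq_nonneg (T ω))
  linarith

/-! ### The decompositions in terms of the mutual informations -/

lemma isPID_dMin {x y : ℝ} (hx : (mutualInfo P T X : EReal) = x)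
    (hy : (mutualInfo P T Y : EReal) = y) (hxy : mutualInfo P T (fun ω ↦ (X ω, Y ω)) = ∞) :
    IsPID P T X Y (dMin P T X Y) ∧
      (dMin P T X Y).UX = ((x - redMin P T X Y : ℝ) : EReal) ∧
      (dMin P T X Y).UY = ((y - redMin P T X Y : ℝ) : EReal) ∧ (dMin P T X Y).S = ⊤ := by
  refine ⟨⟨?_, ?_, ?_⟩, ?_, ?_, ?_⟩ <;>
    simp only [dMin, hx, hy, hxy, ← EReal.coe_sub, ← EReal.coe_add, EReal.coe_ennreal_top,
      EReal.top_sub_coe, EReal.coe_add_top, add_sub_cancel]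

lemma isPID_dPM {x y : ℝ} (hx : (mutualInfo P T X : EReal) = x)
    (hy : (mutualInfo P T Y : EReal) = y) (hxy : mutualInfo P T (fun ω ↦ (X ω, Y ω)) = ∞)
    (hx' : x = specificity P X - ambiguity P T X) (hy' : y = specificity P Y - ambiguity P T Y) :
    IsPID P T X Y (dPM P T X Y) ∧ (dPM P T X Y).S = ⊤ := by
  refine ⟨⟨?_, ?_, ?_⟩, ?_⟩ <;>
    simp only [dPM, hx, hy, hxy, ← EReal.coe_add, EReal.coe_ennreal_top,
      EReal.top_sub_coe, EReal.coe_add_top, EReal.coe_eq_coe_iff]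
  · rw [hx', redPM, uniquePMX]; ring
  · rw [hy', redPM, uniquePMY]; ring

end PID

/-! ### Gaussian predictors and a linear target -/

open PID in
theorem mainTheorem3 {Ω : Type*} [MeasurableSpace Ω] (P : Measure Ω) [IsProbabilityMeasure P]
    (X Y T : Ω → ℝ) (hX : Measurable X) (hY : Measurable Y)
    (ρ : ℝ) (hρ : ρ ∈ Set.Ioo (-1 : ℝ) 1)
    (hXY : PID.IsNormalizedGaussianPair P X Y ρ)
    (a b : ℝ) (ha : 0 < a) (hab : a < b)
    (hT : ∀ ω, T ω = a * X ω + b * Y ω)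
    (σ : ℝ) (hσ : σ = Real.sqrt (a ^ 2 + b ^ 2 + 2 * ρ * a * b)) :
    -- the quantities are well defined and the mutual information of the predictors is as claimed
    PID.HasDensities P T X Y ∧
    (PID.mutualInfo P X Y : EReal) = ((-Real.log (Real.sqrt (1 - ρ ^ 2)) : ℝ) : EReal) ∧
    -- the decomposition of the redundancy `I_∩^min`
    (PID.MinWellDefined P T X Y ∧
      PID.IsPID P T X Y (PID.dMin P T X Y) ∧
      (PID.dMin P T X Y).R =
        ((-Real.log b + Real.log σ : ℝ) : EReal) + (PID.mutualInfo P X Y : EReal) ∧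
      (PID.dMin P T X Y).R =
        ((Real.log (σ / (b * Real.sqrt (1 - ρ ^ 2))) : ℝ) : EReal) ∧
      (PID.dMin P T X Y).UX = 0 ∧
      (PID.dMin P T X Y).UY = ((Real.log (b / a) : ℝ) : EReal) ∧
      (PID.dMin P T X Y).S = ⊤) ∧
    -- the decomposition of the redundancy `I_∩^PM`
    (PID.PMWellDefined P T X Y ∧
      PID.IsPID P T X Y (PID.dPM P T X Y) ∧
      (PID.dPM P T X Y).R =
        ((-Real.log a + Real.log σ - Real.sqrt (1 - ρ ^ 2) / Real.pi : ℝ) : EReal)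
          + (PID.mutualInfo P X Y : EReal) ∧
      (PID.dPM P T X Y).UX =
        ((Real.sqrt (1 - ρ ^ 2) / Real.pi - Real.log (b / a) : ℝ) : EReal) ∧
      (PID.dPM P T X Y).UY = ((Real.sqrt (1 - ρ ^ 2) / Real.pi : ℝ) : EReal) ∧
      (PID.dPM P T X Y).S = ⊤) := by
  have hb : 0 < b := ha.trans hab
  have hs2 : 0 < 1 - ρ ^ 2 := by nlinarith [hρ.1, hρ.2]
  have hq_pos : 0 < a ^ 2 + b ^ 2 + 2 * ρ * a * b := by
    nlinarith [sq_nonneg (a + ρ * b), mul_pos hs2 (pow_pos hb 2)]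
  have hσ0 : 0 < σ := hσ ▸ Real.sqrt_pos.2 hq_pos
  have hσ2 : σ ^ 2 = a ^ 2 + b ^ 2 + 2 * ρ * a * b := hσ ▸ Real.sq_sqrt hq_pos.le
  set s := √(1 - ρ ^ 2) with hs
  have hs0 : 0 < s := Real.sqrt_pos.2 hs2
  have hss : s ^ 2 = 1 - ρ ^ 2 := Real.sq_sqrt hs2.le
  have hT' : T = fun ω ↦ a * X ω + b * Y ω := funext hT
  have hTm : Measurable T := hT' ▸ by fun_prop
  -- The regressions of `Y` on `X`, of `X` on `T`, and of `Y` on `T`.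
  have rXY := hXY.isGaussianRegression hX hY hρ (T := X) (U := Y) (α := 1) (β := 0) (γ := 0)
    (δ := 1) (k := ρ) (τ := 1) (v := 1) (w := s ^ 2) (by simp) (by simp) one_pos one_pos
    (by positivity) (by ring) (by ring) (by ring) (by rw [hss]; ring)
  have rX := hXY.isGaussianRegression hX hY hρ (T := T) (U := X) (γ := 1)
    (δ := 0) (k := (a + ρ * b) / σ ^ 2) (τ := σ ^ 2) (v := 1) (w := (b * s / σ) ^ 2) hT (by simp)
    (by positivity) one_pos (by positivity) hσ2.symm (by ring)
    (by field_simp; ring) (by field_simp; rw [hss, hσ2]; ring)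
  have rY := hXY.isGaussianRegression hX hY hρ (T := T) (U := Y) (γ := 0)
    (δ := 1) (k := (b + ρ * a) / σ ^ 2) (τ := σ ^ 2) (v := 1) (w := (a * s / σ) ^ 2) hT (by simp)
    (by positivity) one_pos (by positivity) hσ2.symm (by ring)
    (by field_simp; ring) (by field_simp; rw [hss, hσ2]; ring)
  simp only [Real.toNNReal_one] at rXY rX rY
  have log_half {x : ℝ} (hx : 0 < x) : Real.log (1 / x ^ 2) / 2 = -Real.log x := by
    rw [one_div, Real.log_inv, Real.log_pow]; push_cast; ring
  have mXY := rXY.mutualInfo_eq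
  have mX := rX.mutualInfo_eq
  have mY := rY.mutualInfo_eq
  rw [Real.coe_toNNReal _ (by positivity), NNReal.coe_one, log_half (by positivity)] at mXY mX mY
  have mTop : mutualInfo P T (fun ω ↦ (X ω, Y ω)) = ∞ := by
    refine mutualInfo_eq_top_of_eq_comp (f := fun p : ℝ × ℝ ↦ a * p.1 + b * p.2) (by fun_prop)
      (by fun_prop) hT fun t ↦ ?_
    rw [rX.map_left]
    have := nullSingletonClass_gaussianReal (μ := 0) rX.left_ne
    exact measure_singleton t
  have hlX : Real.log (b * s / σ) = Real.log b + Real.log s - Real.log σ := by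
    rw [Real.log_div (by positivity) hσ0.ne', Real.log_mul hb.ne' hs0.ne']
  have hlY : Real.log (a * s / σ) = Real.log a + Real.log s - Real.log σ := by
    rw [Real.log_div (by positivity) hσ0.ne', Real.log_mul ha.ne' hs0.ne']
  have hlab : Real.log (b / a) = Real.log b - Real.log a := Real.log_div hb.ne' ha.ne'
  -- The squared correlation with `T` is larger for `Y`, so the minimum is always `I_X(T)`.
  have hwle : a * s / σ ≤ b * s / σ := by gcongr
  have hw1 : (b * s / σ) ^ 2 ≤ 1 := by
    rw [div_pow, div_le_one (by positivity), mul_pow, hss, hσ2]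
    nlinarith [sq_nonneg (a + ρ * b)]
  have hk : ((a + ρ * b) / σ ^ 2) ^ 2 ≤ ((b + ρ * a) / σ ^ 2) ^ 2 := by
    rw [div_pow, div_pow]
    gcongr ?_ / _
    nlinarith [mul_pos hs2 (mul_pos (sub_pos.2 hab) (add_pos ha hb))]
  have hmin := ae_minSpecificInfo_eq rX rY (Real.toNNReal_le_toNNReal (by gcongr))
    (Real.toNNReal_le_one.2 hw1) hk
  have hredMin : redMin P T X Y = -Real.log (b * s / σ) := by
    rw [redMin, integral_congr_ae hmin, rX.integral_specificInfo,
      Real.coe_toNNReal _ (by positivity), Real.coe_toNNReal _ (by positivity), NNReal.coe_one,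
      log_half (by positivity)]
    have : (b * s / σ) ^ 2 + ((a + ρ * b) / σ ^ 2) ^ 2 * σ ^ 2 = 1 := by
      field_simp; rw [hss, hσ2]; ring
    rw [this]; ring
  have hsX : specificity P X = Real.log (2 * Real.pi) / 2 + 1 / 2 := by
    simpa using specificity_eq hX one_ne_zero rX.map_right
  have hsY : specificity P Y = Real.log (2 * Real.pi) / 2 + 1 / 2 := by
    simpa using specificity_eq hY one_ne_zero rY.map_right
  have hredS : redSpecificity P X Y = Real.log (2 * Real.pi) / 2 + 1 / 2 - s / Real.pi := by
    rw [redSpecificity_eq hX hY rX.map_right rY.map_right,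
      hXY.integral_min_sq hX hY hρ rX.map_right rY.map_right]
    ring
  have log_amb {x : ℝ} (hx : 0 < x) :
      Real.log (2 * Real.pi * x ^ 2) / 2 = Real.log (2 * Real.pi) / 2 + Real.log x := by
    rw [Real.log_mul (by positivity) (by positivity), Real.log_pow]; push_cast; ring
  have haX := rX.ambiguity_eq
  have haY := rY.ambiguity_eq
  rw [Real.coe_toNNReal _ (by positivity), log_amb (by positivity)] at haX haY
  -- The residuals satisfy `a R_X + b R_Y = 0` and their standard deviations are in the ratio
  -- `b : a`, so the standardized squared residuals of `X` and `Y` coincide. The two ambiguities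
  -- thus differ by a constant, and the minimum is the ambiguity of `Y` almost everywhere.
  have hamb : (fun ω ↦ min (ptAmbiguity P T X ω) (ptAmbiguity P T Y ω)) =ᵐ[P]
      ptAmbiguity P T Y := by
    filter_upwards [rX.ae_ptAmbiguity_eq, rY.ae_ptAmbiguity_eq] with ω h1 h2
    refine min_eq_right ?_
    rw [h1, h2, Real.coe_toNNReal _ (by positivity), Real.coe_toNNReal _ (by positivity),
      log_amb (by positivity), log_amb (by positivity)]
    have hres : (Y ω - (b + ρ * a) / σ ^ 2 * T ω) ^ 2 / (2 * (a * s / σ) ^ 2)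
        = (X ω - (a + ρ * b) / σ ^ 2 * T ω) ^ 2 / (2 * (b * s / σ) ^ 2) := by
      have e1 : Y ω - (b + ρ * a) / σ ^ 2 * T ω
          = a * (((a + ρ * b) * Y ω - (b + ρ * a) * X ω) / σ ^ 2) := by
        rw [hT]; field_simp; rw [hσ2]; ring
      have e2 : X ω - (a + ρ * b) / σ ^ 2 * T ω
          = -b * (((a + ρ * b) * Y ω - (b + ρ * a) * X ω) / σ ^ 2) := by
        rw [hT]; field_simp; rw [hσ2]; ring
      rw [e1, e2]; field_simp
    rw [hres]
    gcongr
  have hredA : redAmbiguity P T X Y = ambiguity P T Y := integral_congr_ae hamb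
  obtain ⟨pidMin, uxMin, uyMin, sMin⟩ := isPID_dMin mX mY mTop
  obtain ⟨pidPM, sPM⟩ := isPID_dPM mX mY mTop (by rw [hsX, haX]; ring) (by rw [hsY, haY]; ring)
  have iSX := integrable_ptSpecificity hX one_ne_zero rX.map_right
  have iSY := integrable_ptSpecificity hY one_ne_zero rY.map_right
  have redMin_eq : (dMin P T X Y).R = ((redMin P T X Y : ℝ) : EReal) := rfl
  have redPM_eq : (dPM P T X Y).R = ((redPM P T X Y : ℝ) : EReal) := rfl
  refine ⟨⟨(dens_ae_eq hX one_ne_zero rX.map_right).1, (dens_ae_eq hY one_ne_zero rY.map_right).1,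
    (dens_ae_eq hTm rX.left_ne rX.map_left).1, rX.jointDens_ae_eq.1, rY.jointDens_ae_eq.1⟩, mXY,
    ⟨⟨rX.ae_specificInfo_eq.mono fun _ h ↦ h.1, rY.ae_specificInfo_eq.mono fun _ h ↦ h.1,
      rX.integrable_specificInfo.congr hmin.symm⟩, pidMin, ?_, ?_, ?_, ?_, sMin⟩,
    ⟨⟨iSX, iSY, rX.integrable_ptAmbiguity, rY.integrable_ptAmbiguity, iSX.inf iSY,
      rX.integrable_ptAmbiguity.inf rY.integrable_ptAmbiguity⟩, pidPM, ?_, ?_, ?_, sPM⟩⟩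
  · rw [redMin_eq, hredMin, mXY, ← EReal.coe_add, hlX]
    congr 1; ring
  · rw [redMin_eq, hredMin, ← Real.log_inv, inv_div]
  · rw [uxMin, hredMin, sub_self, EReal.coe_zero]
  · rw [uyMin, hredMin, hlX, hlY, hlab]
    congr 1; ring
  · rw [redPM_eq, redPM, hredS, hredA, haY, mXY, ← EReal.coe_add, hlY]
    congr 1; ring
  · change ((uniquePMX P T X Y : ℝ) : EReal) = _
    rw [uniquePMX, hsX, hredS, hredA, haX, haY, hlX, hlY, hlab]
    congr 1; ring
  · change ((uniquePMY P T X Y : ℝ) : EReal) = _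
    rw [uniquePMY, hsY, hredS, hredA]
    congr 1; ring
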